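/- Let $d\ge 1$ and let $\Gamma=(\mathcal V,\mathcal E)$ be a connected $\mathbb Z^d$-periodic graph, that is, a connected graph without self-loops or multiple edges, with a free action $u\mapsto u+a$ ($a\in\mathbb Z^d$) of $\mathbb Z^d$ on $\mathcal V$ which maps edges to edges and for which the quotient graph $\Gamma/\mathbb Z^d$ has finitely many vertices and edges. Let $\mathbb C^{V,E}$ be the (finite-dimensional) space of all labelings $(v,e)$ of $\Gamma$, where $v:\mathcal V\to\mathbb C$ is a $\mathbb Z^d$-periodic potential and $e:\mathcal E\to\mathbb C$ is a symmetric, $\mathbb Z^d$-periodic edge labeling, i.e. $e((u,w))=e((w,u))=e((u+a,w+a))$ for every edge $(u,w)$ and every $a\in\mathbb Z^d$. For a fundamental domain $W\subset\mathcal V$ (a finite set with $\bigcup_{a\in\mathbb Z^d}(W+a)=\mathcal V$ and $|W|=|\mathcal V/\mathbb Z^d|$), let $L(v,e,z)$ be the $W\times W$ Floquet matrix with Laurent polynomial entries $$L(v,e,z)_{u,w}=\delta_{u,w}\,v(u)+\sum_{a\in\mathbb Z^d:\ (u,w+a)\in\mathcal E} e((u,w+a))\,z^a ,$$ and let $D(v,e,z,\lambda)=\det(L(v,e,z)-\lambda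 I)\in\mathbb C[z_1^{\pm1},\dots,z_d^{\pm1}][\lambda]$ be the dispersion polynomial. Then there is a proper algebraic subset $S$ of $\mathbb C^{V,E}$ such that for every $(v,e)\in\mathbb C^{V,E}\setminus S$ and every fundamental domain $W$, the polynomial $D(v,e,z,\lambda)$ has no linear factor in $\lambda$, i.e. there is no constant $\lambda_0\in\mathbb C$ such that $\lambda-\lambda_0$ divides $D(v,e,z,\lambda)$. In other words, the periodic operator generically has no flat bands. -/

import Mathlib

open scoped Polynomial

/-- `G` is a `ℤ^d`-periodic graph with respect to the given action of `ℤ^d` on its vertices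
(`a +ᵥ u` is the vertex `u + a`).  The graph is simple: no self-loops, no multiple edges. -/
structure IsPeriodicGraph (d : ℕ) {𝒱 : Type*} [AddAction (Fin d → ℤ) 𝒱]
    (G : SimpleGraph 𝒱) : Prop where
  /-- The action is free. -/
  free : ∀ (a : Fin d → ℤ) (u : 𝒱), a +ᵥ u = u → a = 0
  /-- Edges are mapped to edges. -/
  adj_vadd : ∀ (a : Fin d → ℤ) (u v : 𝒱), G.Adj u v → G.Adj (a +ᵥ u) (a +ᵥ v)
  /-- The quotient graph has finitely many vertices. -/
  finite_vertexOrbits : Finite (AddAction.orbitRel.Quotient (Fin d → ℤ) 𝒱)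
  /-- The quotient graph has finitely many edges: every edge is a translate of one of
  finitely many. -/
  finite_edgeOrbits : ∃ F : Finset (𝒱 × 𝒱), ∀ u v : 𝒱, G.Adj u v →
    ∃ a : Fin d → ℤ, (a +ᵥ u, a +ᵥ v) ∈ F

/-- Between a vertex `u` and the orbit of a vertex `v` there are only finitely many edges. -/
theorem IsPeriodicGraph.finite_shifts {d : ℕ} {𝒱 : Type*} [AddAction (Fin d → ℤ) 𝒱]
    {G : SimpleGraph 𝒱} (hG : IsPeriodicGraph d G) (u v : 𝒱) :
    {a : Fin d → ℤ | G.Adj u (a +ᵥ v)}.Finite := by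
  have inj : ∀ (a b : Fin d → ℤ) (x : 𝒱), a +ᵥ x = b +ᵥ x → a = b := by
    intro a b x h
    have h2 : (-b + a) +ᵥ x = x := by rw [add_vadd, h, neg_vadd_vadd]
    exact (neg_add_eq_zero.mp (hG.free _ _ h2)).symm
  obtain ⟨F, hF⟩ := hG.finite_edgeOrbits
  choose! b hb using hF
  refine Set.Finite.of_finite_image (F.finite_toSet.subset ?_)
    (f := fun a => (b u (a +ᵥ v) +ᵥ u, b u (a +ᵥ v) +ᵥ (a +ᵥ v))) ?_
  · rintro _ ⟨a, ha, rfl⟩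
    exact hb _ _ ha
  · intro a _ a' _ h
    simp only [Prod.mk.injEq] at h
    have h1 := inj _ _ _ h.1
    have h2 := h.2
    rw [h1] at h2
    exact inj _ _ _ (vadd_left_cancel _ h2)

/-- The space `ℂ^{V,E}` of labelings `(V, E)` of a periodic graph: a periodic potential `V`
on the vertices and a symmetric periodic function `E` on the edges.  The function `E` is
represented by its extension by zero to all pairs of vertices. -/
@[ext]
structure PeriodicLabeling (d : ℕ) {𝒱 : Type*} [AddAction (Fin d → ℤ) 𝒱]
    (G : SimpleGraph 𝒱) where
  V : 𝒱 → ℂ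
  E : 𝒱 → 𝒱 → ℂ
  V_vadd : ∀ (a : Fin d → ℤ) (u : 𝒱), V (a +ᵥ u) = V u
  E_symm : ∀ u v : 𝒱, E u v = E v u
  E_vadd : ∀ (a : Fin d → ℤ) (u v : 𝒱), E (a +ᵥ u) (a +ᵥ v) = E u v
  E_eq_zero : ∀ u v : 𝒱, ¬ G.Adj u v → E u v = 0

/-- All values of a labeling, on vertices and on pairs of vertices.  By periodicity these are
copies of finitely many of them (one for each orbit of vertices and of edges), which are the
linear coordinates of `ℂ^{V,E}`, together with zeros. -/
def PeriodicLabeling.values {d : ℕ} {𝒱 : Type*} [AddAction (Fin d → ℤ) 𝒱]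
    {G : SimpleGraph 𝒱} (ℓ : PeriodicLabeling d G) : 𝒱 ⊕ 𝒱 × 𝒱 → ℂ :=
  Sum.elim ℓ.V (fun p => ℓ.E p.1 p.2)

/-- Algebraic subsets of `ℂ^{V,E}`: the common zero sets of families of polynomials in the
vertex and edge labels. -/
def IsAlgebraicSubset {d : ℕ} {𝒱 : Type*} [AddAction (Fin d → ℤ) 𝒱]
    {G : SimpleGraph 𝒱} (S : Set (PeriodicLabeling d G)) : Prop :=
  ∃ P : Set (MvPolynomial (𝒱 ⊕ 𝒱 × 𝒱) ℂ),
    S = {ℓ | ∀ p ∈ P, MvPolynomial.eval ℓ.values p = 0}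

/-- A (vertex) fundamental domain: a finite set of vertices whose translates cover all the
vertices, with as many elements as there are orbits. -/
def IsVertexFundamentalDomain (d : ℕ) {𝒱 : Type*} [AddAction (Fin d → ℤ) 𝒱]
    (W : Finset 𝒱) : Prop :=
  (∀ u : 𝒱, ∃ a : Fin d → ℤ, ∃ w ∈ W, a +ᵥ w = u) ∧
    W.card = Nat.card (AddAction.orbitRel.Quotient (Fin d → ℤ) 𝒱)

/-- The ring `ℂ[z₁^±, …, z_d^±]` of Laurent polynomials. -/
abbrev LaurentRing (d : ℕ) : Type := AddMonoidAlgebra ℂ (Fin d → ℤ)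

open Classical in
/-- The Floquet matrix `L(z)`, with rows and columns indexed by `W`:
`L(z)_{u,v} = δ_{u,v} V(u) + ∑_{a : (u, v+a) is an edge} E(u, v+a) z^a`. -/
noncomputable def floquetMatrix {d : ℕ} {𝒱 : Type*} [AddAction (Fin d → ℤ) 𝒱]
    {G : SimpleGraph 𝒱} (hG : IsPeriodicGraph d G) (ℓ : PeriodicLabeling d G)
    (W : Finset 𝒱) : Matrix W W (LaurentRing d) :=
  Matrix.of fun u v =>
    (if u = v then algebraMap ℂ (LaurentRing d) (ℓ.V u) else 0) +
      ∑ a ∈ (hG.finite_shifts (u : 𝒱) (v : 𝒱)).toFinset,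
        AddMonoidAlgebra.single a (ℓ.E u (a +ᵥ (v : 𝒱)))

open Classical in
/-- The dispersion polynomial `D(z, λ) = det (L(z) - λ I)`, a polynomial in `λ` over the
Laurent polynomials in `z`. -/
noncomputable def dispersionPolynomial {d : ℕ} {𝒱 : Type*} [AddAction (Fin d → ℤ) 𝒱]
    {G : SimpleGraph 𝒱} (hG : IsPeriodicGraph d G) (ℓ : PeriodicLabeling d G)
    (W : Finset 𝒱) : (LaurentRing d)[X] :=
  ((floquetMatrix hG ℓ W).map Polynomial.C - (Polynomial.X : (LaurentRing d)[X]) • 1).det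

/-- `D` has a linear factor in `λ`: there is a constant `λ₀ ∈ ℂ` such that `λ - λ₀` divides
`D(z, λ)`. -/
def HasLinearFactor {d : ℕ} (D : (LaurentRing d)[X]) : Prop :=
  ∃ lam : ℂ, (Polynomial.X - Polynomial.C (algebraMap ℂ (LaurentRing d) lam)) ∣ D

/-!
A flat band `λ₀` of a labeling is an eigenvalue of its Floquet matrix at every point of the torus,
in particular at any two points `χ₁`, `χ₂`.  That the matrices at `χ₁` and `χ₂` share an eigenvalue
is the vanishing of a polynomial in the labels, the determinant of the value of one characteristic
polynomial at the other matrix (`Matrix.det_aeval_charpoly_eq_zero`).  The spectra do not depend on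
the fundamental domain, since another choice conjugates the Floquet matrix by a diagonal matrix of
monomials (`PeriodicLabeling.charpoly_floquetAt_eq`).  So it is enough to find two points and one
labeling for which the spectra are disjoint.

All edge labels are taken equal to `1`, and the potential generic.  Let `A` and `B` be the matrices
at `χ₁ = (1, …, 1)` and `χ₂ = (t, 1, …, 1)`, for zero potential.  The polynomial
`det (diagonal x + A)` has degree one in each variable, so its factors have disjoint sets of
variables, and letting all but two variables tend to infinity shows that such a
factorization decouples these sets in `A`.  As the graph is connected and `A` has nonnegative
entries, the polynomial is irreducible (`Matrix.irreducible_det_addGenericDiagonal`), and hence so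
is the characteristic polynomial of `A` with generic potential.  By Gauss's lemma it is then coprime
to that of `B` over the field of rational functions in the potential, unless the two
agree (`Matrix.exists_det_aeval_charpoly_diagonal_add_ne_zero`).

They do not agree: otherwise `A ^ k` and `B ^ k` would have equal traces for all `k`.  But these
traces are sums of positive weights of closed walks in the quotient graph, and a walk of length `k`
from a vertex to its translate by the first basis vector has weight `t` in the trace of `B ^ k`,
which exceeds the trace of `A ^ k` for large `t` (`IsPeriodicGraph.exists_charpoly_quotientAdj_ne`).
-/

/-! ### The determinant of a matrix with generic diagonal -/

namespace Matrix

section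

variable {n : Type*} [DecidableEq n]

/-- The matrix `A` with an independent indeterminate added to each diagonal entry. -/
noncomputable def addGenericDiagonal (A : Matrix n n ℂ) : Matrix n n (MvPolynomial n ℂ) :=
  diagonal MvPolynomial.X + A.map MvPolynomial.C

theorem addGenericDiagonal_apply (A : Matrix n n ℂ) (i j : n) :
    A.addGenericDiagonal i j = (if i = j then MvPolynomial.X i else 0) + MvPolynomial.C (A i j) := by
  rw [addGenericDiagonal, add_apply, diagonal_apply, map_apply]

theorem map_eval_addGenericDiagonal (A : Matrix n n ℂ) (x : n → ℂ) :
    A.addGenericDiagonal.map (MvPolynomial.eval x) = diagonal x + A := by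
  ext i j
  by_cases h : i = j
  · subst h; simp [addGenericDiagonal_apply]
  · simp [addGenericDiagonal_apply, h]

variable [Fintype n]

theorem eval_det_addGenericDiagonal (A : Matrix n n ℂ) (x : n → ℂ) :
    MvPolynomial.eval x A.addGenericDiagonal.det = (diagonal x + A).det := by
  rw [RingHom.map_det, RingHom.mapMatrix_apply, map_eval_addGenericDiagonal]

/-- The determinant has degree at most one in each variable, hence each variable occurs in at most
one of its irreducible factors. -/
theorem degreeOf_det_addGenericDiagonal_le (A : Matrix n n ℂ) (i : n) :
    A.addGenericDiagonal.det.degreeOf i ≤ 1 := by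
  rw [det_apply]
  refine (MvPolynomial.degreeOf_sum_le _ _ _).trans (Finset.sup_le fun σ _ => ?_)
  have h1 : Equiv.Perm.sign σ • ∏ j, A.addGenericDiagonal (σ j) j =
      MvPolynomial.C (((Equiv.Perm.sign σ : ℤˣ) : ℤ) : ℂ) *
        ∏ j, A.addGenericDiagonal (σ j) j := by
    rw [Units.smul_def, zsmul_eq_mul]
    simp
  rw [h1]
  refine (MvPolynomial.degreeOf_C_mul_le _ _ _).trans
    ((MvPolynomial.degreeOf_prod_le _ _ _).trans ?_)
  calc ∑ j, (A.addGenericDiagonal (σ j) j).degreeOf i ≤ ∑ j, if i = j then 1 else 0 := by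
        refine Finset.sum_le_sum fun j _ => ?_
        rw [addGenericDiagonal_apply]
        refine (MvPolynomial.degreeOf_add_le _ _ _).trans (max_le ?_ ?_)
        · by_cases hj : σ j = j
          · rw [hj, if_pos rfl, MvPolynomial.degreeOf_X]
          · simp [hj]
        · simp
    _ = 1 := by simp

/-- The matrix whose rows `u` and `w` are those of `A` with `a`, `b` added on the diagonal, and
whose other rows are those of `1 + s • A`.  For `s ≠ 0` it is, up to scaling rows, of the form
`diagonal x + A`; the value `s = 0` isolates the `2 × 2` block of `A` on `{u, w}`. -/
def rescaledBlock (A : Matrix n n ℂ) (u w : n) (s a b : ℂ) : Matrix n n ℂ :=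
  of fun i j => if i = u then (if j = u then a else 0) + A u j
    else if i = w then (if j = w then b else 0) + A w j
    else (if i = j then 1 else 0) + s * A i j

theorem det_rescaledBlock_zero (A : Matrix n n ℂ) {u w : n} (huw : u ≠ w) (a b : ℂ) :
    (A.rescaledBlock u w 0 a b).det = (a + A u u) * (b + A w w) - A u w * A w u := by
  -- the matrix is a rank two perturbation of the identity
  let P : Matrix n (Fin 2) ℂ := of fun i k => if i = (![u, w] k) then 1 else 0
  let R : Matrix (Fin 2) n ℂ :=
    of ![fun j => (if j = u then a - 1 else 0) + A u j, fun j => (if j = w then b - 1 else 0) + A w j]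
  have h : A.rescaledBlock u w 0 a b = 1 + P * R := by
    ext i j
    simp only [rescaledBlock, of_apply, add_apply, mul_apply, Fin.sum_univ_two, one_apply, P, R]
    by_cases h1 : i = u
    · subst h1
      by_cases h2 : j = i
      · subst h2; simp [huw]; ring
      · simp [huw, h2, Ne.symm h2]
    · by_cases h2 : i = w
      · subst h2
        by_cases h3 : j = i
        · subst h3; simp [huw.symm]; ring
        · simp [huw.symm, h3, Ne.symm h3]
      · simp [h1, h2]
  have hRP : R * P = R.submatrix id ![u, w] := by
    ext k l
    simp [P, mul_apply]
  rw [h, det_one_add_mul_comm, det_fin_two, hRP]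
  simp [R, huw, huw.symm]
  ring

theorem det_rescaledBlock (A : Matrix n n ℂ) {u w : n} (huw : u ≠ w) {s : ℂ} (hs : s ≠ 0)
    (a b : ℂ) :
    (A.rescaledBlock u w s a b).det = (∏ i, if i = u ∨ i = w then 1 else s) *
      (diagonal (Function.update (Function.update (fun _ => s⁻¹) u a) w b) + A).det := by
  rw [← det_diagonal, ← det_mul]
  congr 1
  ext i j
  rw [diagonal_mul, rescaledBlock, of_apply, add_apply]
  by_cases h1 : i = u
  · subst h1
    by_cases h2 : j = i
    · subst h2; simp [huw]
    · simp [h2, Ne.symm h2]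
  · by_cases h2 : i = w
    · subst h2
      by_cases h3 : j = i
      · subst h3; simp [h1]
      · simp [h1, h3, Ne.symm h3]
    · by_cases h3 : i = j
      · subst h3; simp [h1, h2]; field_simp
      · simp [h1, h2, h3]

theorem continuous_det_rescaledBlock (A : Matrix n n ℂ) (u w : n) (a b : ℂ) :
    Continuous fun s => (A.rescaledBlock u w s a b).det := by
  refine Continuous.matrix_det (continuous_matrix fun i j => ?_)
  simp only [rescaledBlock, of_apply]
  split_ifs <;> fun_prop

end

end Matrix

theorem MvPolynomial.eval_update_eq_of_degreeOf_eq_zero {σ R : Type*} [DecidableEq σ]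
    [CommSemiring R] {p : MvPolynomial σ R} {i : σ} (h : p.degreeOf i = 0) (x : σ → R) (c : R) :
    eval (Function.update x i c) p = eval x p := by
  refine eval₂Hom_congr' rfl (fun j hj _ => ?_) rfl
  have hji : j ≠ i := by
    rintro rfl
    exact mem_vars_iff_degreeOf_ne_zero.mp hj h
  rw [Function.update_of_ne hji]

theorem MvPolynomial.isUnit_of_degreeOf_eq_zero {σ K : Type*} [Field K] {p : MvPolynomial σ K}
    (h0 : p ≠ 0) (h : ∀ i, p.degreeOf i = 0) : IsUnit p := by
  have h1 : p.vars = ∅ := by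
    refine Finset.eq_empty_of_forall_notMem fun i hi => ?_
    exact mem_vars_iff_degreeOf_ne_zero.mp hi (h i)
  obtain ⟨c, rfl⟩ : ∃ c, p = C c := ⟨_, vars_eq_empty_iff_eq_C.mp h1⟩
  have : c ≠ 0 := by rintro rfl; simp at h0
  exact (isUnit_iff_ne_zero.mpr this).map C

namespace Matrix

variable {n : Type*} [Fintype n] [DecidableEq n]

/-- If `A u w` and `A w u` are nonzero, the variables `u` and `w` cannot be separated by a
factorization of `det A.addGenericDiagonal`: a separated determinant `F (a, b)`, as a function of
these two variables, satisfies `F (a, b) F (a', b') = F (a, b') F (a', b)`, and this persists when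
the other variables tend to infinity, where `F` becomes, up to scaling, the determinant
`(a + A u u) (b + A w w) - A u w A w u` of a `2 × 2` block. -/
theorem mul_eq_zero_of_det_eq_mul {A : Matrix n n ℂ} {g h : MvPolynomial n ℂ}
    (hgh : A.addGenericDiagonal.det = g * h) {u w : n} (huw : u ≠ w)
    (hu : h.degreeOf u = 0) (hw : g.degreeOf w = 0) : A u w * A w u = 0 := by
  have hF (s : ℂ) (a b : ℂ) :
      (diagonal (Function.update (Function.update (fun _ => s⁻¹) u a) w b) + A).det =
        MvPolynomial.eval (Function.update (fun _ => s⁻¹) u a) g *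
          MvPolynomial.eval (Function.update (fun _ => s⁻¹) w b) h := by
    rw [← eval_det_addGenericDiagonal, hgh, map_mul,
      MvPolynomial.eval_update_eq_of_degreeOf_eq_zero hw, Function.update_comm huw,
      MvPolynomial.eval_update_eq_of_degreeOf_eq_zero hu]
  have key (a b a' b' : ℂ) : (fun s => (A.rescaledBlock u w s a b).det *
      (A.rescaledBlock u w s a' b').det) = fun s => (A.rescaledBlock u w s a b').det *
      (A.rescaledBlock u w s a' b).det := by
    refine Continuous.ext_on (dense_compl_singleton (0 : ℂ))
      ((continuous_det_rescaledBlock ..).mul (continuous_det_rescaledBlock ..))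
      ((continuous_det_rescaledBlock ..).mul (continuous_det_rescaledBlock ..)) fun s hs => ?_
    have hs : s ≠ 0 := hs
    simp only [det_rescaledBlock A huw hs, hF]
    ring
  -- with `p = A u w * A w u`, the identity at these arguments reads `-p * (1 - p) = p ^ 2`
  have h1 := congrFun (key (-A u u) (-A w w) (1 - A u u) (1 - A w w)) 0
  simp only [det_rescaledBlock_zero A huw] at h1
  linear_combination -h1

/-- If no two complementary nonempty sets of indices are decoupled by `A`, the polynomial
`det A.addGenericDiagonal` in as many variables as there are indices is irreducible. -/
theorem irreducible_det_addGenericDiagonal [Nonempty n] {A : Matrix n n ℂ}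
    (hA : ∀ U : Set n, U.Nonempty → Uᶜ.Nonempty → ∃ u ∈ U, ∃ w ∉ U, A u w * A w u ≠ 0) :
    Irreducible A.addGenericDiagonal.det := by
  set F := A.addGenericDiagonal.det with hFdef
  have hF0 : F ≠ 0 := by
    intro h0
    obtain ⟨x, hx⟩ : ∃ x : ℂ, A.charpoly.eval x ≠ 0 := by
      by_contra! h
      exact A.charpoly_monic.ne_zero (Polynomial.funext fun x => by simpa using h x)
    have h1 := eval_det_addGenericDiagonal (-A) (fun _ => x)
    have h2 := eval_det_addGenericDiagonal A (fun _ => -x)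
    rw [← hFdef, h0, map_zero] at h2
    apply hx
    rw [eval_charpoly]
    have h3 : scalar n x - A = -(diagonal (fun _ => -x) + A) := by
      ext i j
      by_cases hij : i = j <;> simp [hij]; ring
    rw [h3, det_neg, ← h2, mul_zero]
  have hadd (g h : MvPolynomial n ℂ) (hgh : F = g * h) (i : n) :
      g.degreeOf i + h.degreeOf i ≤ 1 := by
    have hg : g ≠ 0 := by rintro rfl; simp [hgh] at hF0
    have hh : h ≠ 0 := by rintro rfl; simp [hgh] at hF0
    rw [← MvPolynomial.degreeOf_mul_eq hg hh, ← hgh]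
    exact degreeOf_det_addGenericDiagonal_le A i
  refine ⟨fun hunit => ?_, fun g h hgh => ?_⟩
  · -- a unit is a constant, but the determinant takes the value zero
    obtain ⟨x, hx⟩ := IsAlgClosed.exists_root A.charpoly (by
      rw [charpoly_degree_eq_dim]; exact_mod_cast Fintype.card_ne_zero)
    have h2 := eval_det_addGenericDiagonal A (fun _ => -x)
    have h3 : diagonal (fun _ => -x) + A = -(scalar n x - A) := by
      ext i j
      by_cases hij : i = j <;> simp [hij]; ring
    rw [Polynomial.IsRoot, eval_charpoly] at hx
    rw [h3, det_neg, hx, mul_zero] at h2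
    exact (hunit.map (MvPolynomial.eval fun _ => -x)).ne_zero h2
  · have hg : g ≠ 0 := by rintro rfl; simp [hgh] at hF0
    have hh : h ≠ 0 := by rintro rfl; simp [hgh] at hF0
    by_contra! hcon
    obtain ⟨i, hi⟩ : ∃ i, g.degreeOf i ≠ 0 := by
      by_contra! h0; exact hcon.1 (MvPolynomial.isUnit_of_degreeOf_eq_zero hg h0)
    obtain ⟨j, hj⟩ : ∃ j, h.degreeOf j ≠ 0 := by
      by_contra! h0; exact hcon.2 (MvPolynomial.isUnit_of_degreeOf_eq_zero hh h0)
    obtain ⟨u, hu, w, hw, huw⟩ := hA {k | g.degreeOf k ≠ 0} ⟨i, hi⟩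
      ⟨j, by have := hadd g h hgh j; simp; omega⟩
    simp only [Set.mem_ofPred_eq, not_not] at hu hw
    refine huw (mul_eq_zero_of_det_eq_mul hgh (fun e => hu (e ▸ hw)) ?_ hw)
    have := hadd g h hgh u
    omega

end Matrix

/-! ### Characteristic polynomials of matrices with generic diagonal -/

/-- The ring endomorphism of `K[x][λ]` which fixes `λ` and sends each `x i` to `x i + c λ`; that
for `-c` is its inverse. -/
noncomputable def MvPolynomial.shearHom {σ K : Type*} [Field K] (c : K) :
    (MvPolynomial σ K)[X] →+* (MvPolynomial σ K)[X] :=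
  Polynomial.eval₂RingHom
    (MvPolynomial.eval₂Hom (Polynomial.C.comp MvPolynomial.C)
      fun i => Polynomial.C (MvPolynomial.X i) + Polynomial.C (MvPolynomial.C c) * Polynomial.X)
    Polynomial.X

theorem MvPolynomial.shearHom_comp {σ K : Type*} [Field K] (c : K) :
    (shearHom (σ := σ) (-c)).comp (shearHom c) = RingHom.id _ := by
  refine Polynomial.ringHom_ext' (MvPolynomial.ringHom_ext (fun a => ?_) fun i => ?_) ?_ <;>
    simp [shearHom]
  ring

namespace Matrix

variable {n : Type*} [Fintype n] [DecidableEq n]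

/-- The polynomial `det (λ - diagonal x - A)` depends on `x - λ` only, so that the substitution
`x ↦ x + λ` removes `λ`. -/
theorem shearHom_charpoly (A : Matrix n n ℂ) :
    MvPolynomial.shearHom 1 A.addGenericDiagonal.charpoly =
      Polynomial.C ((-1) ^ Fintype.card n *
        A.addGenericDiagonal.det) := by
  rw [← det_neg, charpoly, RingHom.map_det, RingHom.map_det]
  congr 1
  refine Matrix.ext fun i j => ?_
  by_cases h : i = j
  · subst h; simp [addGenericDiagonal_apply, MvPolynomial.shearHom]; ring
  · simp [addGenericDiagonal_apply, h, MvPolynomial.shearHom]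

theorem irreducible_charpoly_addGenericDiagonal [Nonempty n] {A : Matrix n n ℂ}
    (hA : ∀ U : Set n, U.Nonempty → Uᶜ.Nonempty → ∃ u ∈ U, ∃ w ∉ U, A u w * A w u ≠ 0) :
    Irreducible A.addGenericDiagonal.charpoly := by
  let e : (MvPolynomial n ℂ)[X] ≃+* (MvPolynomial n ℂ)[X] :=
    RingEquiv.ofRingHom (MvPolynomial.shearHom 1) (MvPolynomial.shearHom (-1))
      (by simpa using MvPolynomial.shearHom_comp (σ := n) (-1 : ℂ))
      (MvPolynomial.shearHom_comp 1)
  rw [← MulEquiv.irreducible_iff e]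
  change Irreducible (MvPolynomial.shearHom 1 _)
  rw [shearHom_charpoly]
  have h := irreducible_det_addGenericDiagonal hA
  have hu : IsUnit ((-1 : MvPolynomial n ℂ) ^ Fintype.card n) := (isUnit_neg_one).pow _
  rw [← irreducible_isUnit_mul hu] at h
  -- a constant polynomial factors only into constants
  refine ⟨fun h1 => h.not_isUnit (Polynomial.isUnit_C.mp h1), fun p q hpq => ?_⟩
  have hdeg : p.natDegree = 0 ∧ q.natDegree = 0 := by
    have hne : p * q ≠ 0 := by rw [← hpq]; exact Polynomial.C_ne_zero.mpr h.ne_zero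
    have := Polynomial.natDegree_mul (left_ne_zero_of_mul hne) (right_ne_zero_of_mul hne)
    rw [← hpq, Polynomial.natDegree_C] at this
    omega
  rw [Polynomial.natDegree_eq_zero, Polynomial.natDegree_eq_zero] at hdeg
  obtain ⟨⟨p, rfl⟩, ⟨q, rfl⟩⟩ := hdeg
  rw [← Polynomial.C_mul] at hpq
  simpa [Polynomial.isUnit_C] using h.isUnit_or_isUnit (Polynomial.C_injective hpq)

/-! ### Detecting common eigenvalues -/

theorem map_aeval {R S : Type*} [CommRing R] [CommRing S] (f : R →+* S)
    (M : Matrix n n R) (p : R[X]) :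
    (Polynomial.aeval M p).map f = Polynomial.aeval (M.map f) (p.map f) := by
  have := Polynomial.map_aeval_eq_aeval_map (φ := f) (ψ := f.mapMatrix) (by
    ext r i j
    by_cases h : i = j <;> simp [algebraMap_matrix_apply, h]) p M
  simpa using this

theorem map_det_aeval_charpoly {R S : Type*} [CommRing R] [CommRing S] (f : R →+* S)
    (M N : Matrix n n R) : f (Polynomial.aeval M N.charpoly).det =
      (Polynomial.aeval (M.map f) (N.map f).charpoly).det := by
  rw [RingHom.map_det, RingHom.mapMatrix_apply, map_aeval, ← charpoly_map]

/-- If the characteristic polynomial of `M` is irreducible, it is coprime over the fraction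
field to that of any `N` with a different one, so that the latter takes an invertible value
at `M`. -/
theorem det_aeval_charpoly_ne_zero {R : Type*} [CommRing R] [IsDomain R] [IsIntegrallyClosed R]
    {M N : Matrix n n R} (hM : Irreducible M.charpoly) (hMN : M.charpoly ≠ N.charpoly) :
    (Polynomial.aeval M N.charpoly).det ≠ 0 := by
  let K := FractionRing R
  let f : R →+* K := algebraMap R K
  have hirr : Irreducible (M.charpoly.map f) :=
    M.charpoly_monic.irreducible_iff_irreducible_map_fraction_map.mp hM
  have hcop : IsCoprime (M.charpoly.map f) (N.charpoly.map f) := by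
    refine hirr.coprime_iff_not_dvd.mpr fun hdvd => hMN ?_
    refine Polynomial.map_injective f (IsFractionRing.injective R K) ?_
    refine (Polynomial.eq_of_monic_of_dvd_of_natDegree_le (M.charpoly_monic.map f)
      (N.charpoly_monic.map f) hdvd ?_).symm
    rw [(M.charpoly_monic).natDegree_map, (N.charpoly_monic).natDegree_map,
      charpoly_natDegree_eq_dim, charpoly_natDegree_eq_dim]
  obtain ⟨p, q, hpq⟩ := hcop
  intro h0
  have h1 : Polynomial.aeval (M.map f) q * Polynomial.aeval (M.map f) (N.map f).charpoly = 1 := by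
    have := congrArg (Polynomial.aeval (M.map f)) hpq
    rwa [map_add, map_mul, map_mul, map_one, ← charpoly_map, ← charpoly_map, aeval_self_charpoly,
      mul_zero, zero_add] at this
  have h2 := map_det_aeval_charpoly f M N
  rw [h0, map_zero] at h2
  have h3 := congrArg det h1
  rw [det_mul, ← h2, mul_zero, det_one] at h3
  exact zero_ne_one h3

/-- A matrix that decouples no two complementary sets of indices can be given a diagonal
perturbation whose spectrum is disjoint from that of the same perturbation of `B`. -/
theorem exists_det_aeval_charpoly_diagonal_add_ne_zero [Nonempty n] {A B : Matrix n n ℂ}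
    (hA : ∀ U : Set n, U.Nonempty → Uᶜ.Nonempty → ∃ u ∈ U, ∃ w ∉ U, A u w * A w u ≠ 0)
    (hAB : A.charpoly ≠ B.charpoly) :
    ∃ v : n → ℂ, (Polynomial.aeval (diagonal v + A) (diagonal v + B).charpoly).det ≠ 0 := by
  have h := det_aeval_charpoly_ne_zero (N := B.addGenericDiagonal)
    (irreducible_charpoly_addGenericDiagonal hA) (fun h => hAB (by
      have h1 := congrArg (Polynomial.map (MvPolynomial.eval (0 : n → ℂ))) h
      rw [← charpoly_map, ← charpoly_map, map_eval_addGenericDiagonal,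
        map_eval_addGenericDiagonal] at h1
      simpa [Pi.zero_def] using h1))
  by_contra! hv
  refine h (MvPolynomial.funext fun v => ?_)
  rw [map_det_aeval_charpoly, map_eval_addGenericDiagonal, map_eval_addGenericDiagonal, hv v,
    map_zero]

/-- A common eigenvalue of `M` and `N` makes the value of the characteristic polynomial of `N`
at `M` singular. -/
theorem det_aeval_charpoly_eq_zero {K : Type*} [Field K] {M N : Matrix n n K} {a : K}
    (hM : M.charpoly.IsRoot a) (hN : N.charpoly.IsRoot a) :
    (Polynomial.aeval M N.charpoly).det = 0 := by
  obtain ⟨q, hq⟩ := Polynomial.dvd_iff_isRoot.mpr hN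
  have h : Polynomial.aeval M (Polynomial.X - Polynomial.C a) = -(scalar n a - M) := by
    simp [algebraMap_eq_diagonal]
  rw [hq, map_mul, det_mul, h, det_neg, ← eval_charpoly, hM.eq_zero, mul_zero, zero_mul]

/-! ### Traces of powers -/

/-- Both sides are products over the roots of `q`, as `A - r` has determinant determined by the
characteristic polynomial. -/
theorem det_aeval_eq_of_charpoly_eq {A B : Matrix n n ℂ} (h : A.charpoly = B.charpoly)
    (q : ℂ[X]) : (Polynomial.aeval A q).det = (Polynomial.aeval B q).det := by
  have hlin (M : Matrix n n ℂ) (r : ℂ) :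
      (Polynomial.aeval M (Polynomial.X - Polynomial.C r)).det =
        (-1) ^ Fintype.card n * M.charpoly.eval r := by
    rw [eval_charpoly, ← det_neg]
    congr 1
    simp [algebraMap_eq_diagonal]
  have key (M : Matrix n n ℂ) : (Polynomial.aeval M q).det = q.leadingCoeff ^ Fintype.card n *
      (q.roots.map fun r => (-1) ^ Fintype.card n * M.charpoly.eval r).prod := by
    conv_lhs => rw [(IsAlgClosed.splits q).eq_prod_roots]
    rw [map_mul, det_mul]
    congr 1
    · simp [algebraMap_eq_diagonal]
    · let φ : ℂ[X] →* ℂ := detMonoidHom.comp (MonoidHomClass.toMonoidHom (Polynomial.aeval M))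
      change φ _ = _
      rw [map_multiset_prod, Multiset.map_map]
      exact congrArg _ (Multiset.map_congr rfl fun r _ => hlin M r)
  rw [key, key, h]

theorem trace_pow_eq_of_charpoly_eq {A B : Matrix n n ℂ} (h : A.charpoly = B.charpoly) (k : ℕ) :
    (A ^ k).trace = (B ^ k).trace := by
  rw [trace_eq_neg_charpoly_nextCoeff, trace_eq_neg_charpoly_nextCoeff]
  congr 2
  refine Polynomial.funext fun x => ?_
  have key (M : Matrix n n ℂ) : scalar n x - M ^ k =
      Polynomial.aeval M (Polynomial.C x - Polynomial.X ^ k) := by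
    simp [algebraMap_eq_diagonal]
  rw [eval_charpoly, eval_charpoly, key, key, det_aeval_eq_of_charpoly_eq h]

end Matrix

/-! ### Floquet matrices at points of the torus -/

section Floquet

variable {d : ℕ} {𝒱 : Type*} [AddAction (Fin d → ℤ) 𝒱] {G : SimpleGraph 𝒱}

/-- The Floquet matrix at the point of the complex torus given by the character `χ` of `ℤ^d`
(the value of `z^a` is `χ a`), for a family `r` of representatives of the vertex orbits. -/
noncomputable def PeriodicLabeling.floquetAt (ℓ : PeriodicLabeling d G) {ι : Type*} [DecidableEq ι]
    (χ : Multiplicative (Fin d → ℤ) →* ℂ) (r : ι → 𝒱) : Matrix ι ι ℂ :=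
  Matrix.of fun i j => (if i = j then ℓ.V (r i) else 0) +
    ∑ᶠ a : Fin d → ℤ, ℓ.E (r i) (a +ᵥ r j) * χ (.ofAdd a)

theorem orbitMk_vadd (a : Fin d → ℤ) (u : 𝒱) :
    (Quotient.mk'' (a +ᵥ u) : AddAction.orbitRel.Quotient (Fin d → ℤ) 𝒱) = Quotient.mk'' u :=
  Quotient.sound' (AddAction.orbitRel_apply.mpr ⟨a, rfl⟩)

theorem exists_vadd_out_eq (u : 𝒱) : ∃ a : Fin d → ℤ,
    a +ᵥ (Quotient.mk'' u : AddAction.orbitRel.Quotient (Fin d → ℤ) 𝒱).out = u :=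
  AddAction.orbitRel_apply.mp (Quotient.exact' (Quotient.out_eq' _).symm)

theorem IsPeriodicGraph.support_subset (hG : IsPeriodicGraph d G) (ℓ : PeriodicLabeling d G)
    (f : (Fin d → ℤ) → ℂ) (u w : 𝒱) :
    (Function.support fun a : Fin d → ℤ => ℓ.E u (a +ᵥ w) * f a) ⊆
      ((hG.finite_shifts u w).toFinset : Set (Fin d → ℤ)) := by
  intro a ha
  simp only [Set.Finite.coe_toFinset]
  by_contra h
  exact ha (by simp only [ℓ.E_eq_zero _ _ h, zero_mul])

theorem IsPeriodicGraph.floquetAt_apply (hG : IsPeriodicGraph d G) (ℓ : PeriodicLabeling d G)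
    {ι : Type*} [DecidableEq ι] (χ : Multiplicative (Fin d → ℤ) →* ℂ) (r : ι → 𝒱) (i j : ι) :
    ℓ.floquetAt χ r i j = (if i = j then ℓ.V (r i) else 0) +
      ∑ a ∈ (hG.finite_shifts (r i) (r j)).toFinset, ℓ.E (r i) (a +ᵥ r j) * χ (.ofAdd a) := by
  rw [PeriodicLabeling.floquetAt, Matrix.of_apply,
    finsum_eq_sum_of_support_subset _ (hG.support_subset ℓ (fun a => χ (.ofAdd a)) _ _)]

/-- Replacing the representatives of the orbits conjugates the Floquet matrix by a diagonal
matrix of monomials. -/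
theorem PeriodicLabeling.charpoly_floquetAt_eq (ℓ : PeriodicLabeling d G)
    {ι κ : Type*} [Fintype ι] [DecidableEq ι] [Fintype κ]
    [DecidableEq κ] (χ : Multiplicative (Fin d → ℤ) →* ℂ) (e : ι ≃ κ) (r : ι → 𝒱) (r' : κ → 𝒱)
    (s : ι → Fin d → ℤ) (h : ∀ i, r i = s i +ᵥ r' (e i)) :
    (ℓ.floquetAt χ r).charpoly = (ℓ.floquetAt χ r').charpoly := by
  have hχ (a : Fin d → ℤ) : χ (.ofAdd a) * χ (.ofAdd (-a)) = 1 := by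
    rw [← map_mul, ← ofAdd_add, add_neg_cancel, ofAdd_zero, map_one]
  let N := Matrix.reindex e.symm e.symm (ℓ.floquetAt χ r')
  have hconj : ℓ.floquetAt χ r = Matrix.diagonal (fun i => χ (.ofAdd (s i))) * N *
      Matrix.diagonal (fun i => χ (.ofAdd (-s i))) := by
    ext i j
    rw [Matrix.mul_diagonal, Matrix.diagonal_mul]
    simp only [N, Matrix.reindex_apply, Matrix.submatrix_apply, Equiv.symm_symm,
      PeriodicLabeling.floquetAt, Matrix.of_apply, e.injective.eq_iff]
    rw [mul_add, add_mul]
    congr 1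
    · by_cases hij : i = j
      · subst hij
        rw [if_pos rfl, if_pos rfl, h i, ℓ.V_vadd]
        linear_combination (-ℓ.V (r' (e i))) * hχ (s i)
      · rw [if_neg hij, if_neg hij, mul_zero, zero_mul]
    · rw [← finsum_comp_equiv (Equiv.addRight (s i - s j)), mul_finsum, finsum_mul]
      refine finsum_congr fun a => ?_
      have h1 : (Equiv.addRight (s i - s j)) a +ᵥ r j = s i +ᵥ (a +ᵥ r' (e j)) := by
        rw [h j, vadd_vadd, vadd_vadd, Equiv.coe_addRight, add_assoc, sub_add_cancel, add_comm]
      rw [h1, h i, ℓ.E_vadd, Equiv.coe_addRight, sub_eq_add_neg, ofAdd_add, ofAdd_add, map_mul,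
        map_mul]
      ring
  have hinv : Matrix.diagonal (fun i => χ (.ofAdd (-s i))) *
      Matrix.diagonal (fun i => χ (.ofAdd (s i))) = 1 := by
    rw [Matrix.diagonal_mul_diagonal, ← Matrix.diagonal_one]
    congr 1
    ext i
    rw [mul_comm, hχ]
  rw [hconj, Matrix.charpoly_mul_comm, ← mul_assoc, hinv, one_mul, Matrix.charpoly_reindex]

open Classical in
/-- A linear factor `λ - λ₀` gives a flat band: `λ₀` is an eigenvalue of the Floquet matrix at
every point of the torus. -/
theorem HasLinearFactor.exists_isRoot {hG : IsPeriodicGraph d G} {ℓ : PeriodicLabeling d G}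
    {W : Finset 𝒱} (h : HasLinearFactor (dispersionPolynomial hG ℓ W)) :
    ∃ lam : ℂ, ∀ χ : Multiplicative (Fin d → ℤ) →* ℂ,
      (ℓ.floquetAt χ (Subtype.val : W → 𝒱)).charpoly.IsRoot lam := by
  obtain ⟨lam, hlam⟩ := h
  refine ⟨lam, fun χ => ?_⟩
  let φ : LaurentRing d →ₐ[ℂ] ℂ := AddMonoidAlgebra.lift ℂ ℂ (Fin d → ℤ) χ
  let Φ : (LaurentRing d)[X] →+* ℂ := Polynomial.eval₂RingHom (φ : LaurentRing d →+* ℂ) lam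
  have hφ (a : Fin d → ℤ) (c : ℂ) : φ (AddMonoidAlgebra.single a c) = c * χ (.ofAdd a) := by
    simp [φ, AddMonoidAlgebra.lift_single]
  have hΦC (m : LaurentRing d) : Φ (Polynomial.C m) = φ m := by simp [Φ]
  have h0 : Φ (dispersionPolynomial hG ℓ W) = 0 := by
    obtain ⟨q, hq⟩ := hlam
    rw [hq, map_mul, map_sub, hΦC, AlgHom.commutes]
    simp [Φ]
  rw [dispersionPolynomial, RingHom.map_det] at h0
  rw [Polynomial.IsRoot, Matrix.eval_charpoly, ← neg_neg (Matrix.scalar _ _ - _), Matrix.det_neg]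
  refine mul_eq_zero_of_right _ (Eq.trans ?_ h0)
  congr 1
  ext i j
  rw [Matrix.neg_apply, Matrix.sub_apply, hG.floquetAt_apply, RingHom.mapMatrix_apply,
    Matrix.map_apply, Matrix.sub_apply, map_sub, Matrix.map_apply, hΦC, floquetMatrix,
    Matrix.of_apply, map_add, map_sum]
  simp only [hφ]
  by_cases hij : i = j
  · subst hij
    rw [if_pos rfl, if_pos rfl, AlgHom.commutes]
    simp [Φ]
  · rw [if_neg hij, if_neg hij]
    simp [hij]

/-- The Floquet matrix at `χ` with indeterminate labels. -/
noncomputable def IsPeriodicGraph.genericFloquetAt (hG : IsPeriodicGraph d G) {ι : Type*}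
    [DecidableEq ι] (χ : Multiplicative (Fin d → ℤ) →* ℂ) (r : ι → 𝒱) :
    Matrix ι ι (MvPolynomial (𝒱 ⊕ 𝒱 × 𝒱) ℂ) :=
  Matrix.of fun i j => (if i = j then MvPolynomial.X (.inl (r i)) else 0) +
    ∑ a ∈ (hG.finite_shifts (r i) (r j)).toFinset,
      MvPolynomial.X (.inr (r i, a +ᵥ r j)) * MvPolynomial.C (χ (.ofAdd a))

theorem IsPeriodicGraph.map_eval_genericFloquetAt (hG : IsPeriodicGraph d G)
    (ℓ : PeriodicLabeling d G) {ι : Type*} [DecidableEq ι]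
    (χ : Multiplicative (Fin d → ℤ) →* ℂ) (r : ι → 𝒱) :
    (hG.genericFloquetAt χ r).map (MvPolynomial.eval ℓ.values) = ℓ.floquetAt χ r := by
  ext i j
  rw [hG.floquetAt_apply, Matrix.map_apply, genericFloquetAt, Matrix.of_apply]
  by_cases hij : i = j
  · subst hij; simp [PeriodicLabeling.values]
  · simp [PeriodicLabeling.values, hij]

/-- A fundamental domain contains exactly one vertex of each orbit, hence a translate of each of
the chosen representatives. -/
theorem IsVertexFundamentalDomain.exists_equiv
    [Finite (AddAction.orbitRel.Quotient (Fin d → ℤ) 𝒱)] {W : Finset 𝒱}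
    (hW : IsVertexFundamentalDomain d W) :
    ∃ (e : W ≃ AddAction.orbitRel.Quotient (Fin d → ℤ) 𝒱) (s : W → Fin d → ℤ),
      ∀ w : W, (w : 𝒱) = s w +ᵥ (e w).out := by
  let f : W → AddAction.orbitRel.Quotient (Fin d → ℤ) 𝒱 := fun w => Quotient.mk'' (w : 𝒱)
  have hf : Function.Surjective f := by
    intro q
    obtain ⟨a, w, hw, h⟩ := hW.1 q.out
    refine ⟨⟨w, hw⟩, ?_⟩
    rw [← Quotient.out_eq' q, ← h]
    exact (orbitMk_vadd a w).symm
  have hb : Function.Bijective f := hf.bijective_of_nat_card_le (by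
    rw [← hW.2, Nat.card_eq_fintype_card, Fintype.card_coe])
  have hs (w : W) : ∃ a : Fin d → ℤ, a +ᵥ (f w).out = (w : 𝒱) :=
    exists_vadd_out_eq _
  choose s hs using hs
  exact ⟨Equiv.ofBijective f hb, s, fun w => (hs w).symm⟩

end Floquet

/-! ### Unit edge labels -/

section UnitWeights

variable {d : ℕ} {𝒱 : Type*} [AddAction (Fin d → ℤ) 𝒱] {G : SimpleGraph 𝒱}

theorem IsPeriodicGraph.adj_vadd_iff (hG : IsPeriodicGraph d G) (a : Fin d → ℤ) (u w : 𝒱) :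
    G.Adj (a +ᵥ u) (a +ᵥ w) ↔ G.Adj u w := by
  refine ⟨fun h => ?_, hG.adj_vadd a u w⟩
  simpa using hG.adj_vadd (-a) _ _ h

open Classical in
/-- The labeling with all edge labels equal to `1` and with potential `v`. -/
noncomputable def IsPeriodicGraph.unitLabeling (hG : IsPeriodicGraph d G)
    (v : AddAction.orbitRel.Quotient (Fin d → ℤ) 𝒱 → ℂ) : PeriodicLabeling d G where
  V u := v (Quotient.mk'' u)
  E u w := if G.Adj u w then 1 else 0
  V_vadd a u := congrArg v (orbitMk_vadd a u)
  E_symm u w := by simp only [G.adj_comm]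
  E_vadd a u w := by simp only [hG.adj_vadd_iff]
  E_eq_zero u w h := if_neg h

/-- The adjacency matrix of the quotient graph, in which an edge from `u` to `w + a`, for `u` and
`w` the chosen representatives of their orbits, has weight `χ a`. -/
noncomputable def IsPeriodicGraph.quotientAdj (hG : IsPeriodicGraph d G)
    (χ : Multiplicative (Fin d → ℤ) →* ℝ) :
    Matrix (AddAction.orbitRel.Quotient (Fin d → ℤ) 𝒱)
      (AddAction.orbitRel.Quotient (Fin d → ℤ) 𝒱) ℝ :=
  Matrix.of fun p q => ∑ a ∈ (hG.finite_shifts p.out q.out).toFinset, χ (.ofAdd a)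

theorem IsPeriodicGraph.floquetAt_unitLabeling (hG : IsPeriodicGraph d G)
    [DecidableEq (AddAction.orbitRel.Quotient (Fin d → ℤ) 𝒱)]
    (v : AddAction.orbitRel.Quotient (Fin d → ℤ) 𝒱 → ℂ)
    (χ : Multiplicative (Fin d → ℤ) →* ℝ) :
    (hG.unitLabeling v).floquetAt ((Complex.ofRealHom : ℝ →* ℂ).comp χ) Quotient.out =
      Matrix.diagonal v + (hG.quotientAdj χ).map Complex.ofRealHom := by
  ext p q
  rw [hG.floquetAt_apply, Matrix.add_apply, Matrix.diagonal_apply, Matrix.map_apply, quotientAdj,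
    Matrix.of_apply, map_sum]
  congr 1
  · by_cases hpq : p = q
    · subst hpq
      rw [if_pos rfl, if_pos rfl, unitLabeling]
      exact congrArg v (Quotient.out_eq' p)
    · rw [if_neg hpq, if_neg hpq]
  · refine Finset.sum_congr rfl fun a ha => ?_
    rw [Set.Finite.mem_toFinset] at ha
    have ha : G.Adj p.out (a +ᵥ q.out) := ha
    simp [unitLabeling, ha]

theorem IsPeriodicGraph.quotientAdj_nonneg (hG : IsPeriodicGraph d G)
    {χ : Multiplicative (Fin d → ℤ) →* ℝ} (hχ : ∀ a, 0 < χ a)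
    (p q : AddAction.orbitRel.Quotient (Fin d → ℤ) 𝒱) : 0 ≤ hG.quotientAdj χ p q :=
  Finset.sum_nonneg fun _ _ => (hχ _).le

theorem IsPeriodicGraph.pow_quotientAdj_nonneg (hG : IsPeriodicGraph d G)
    [Fintype (AddAction.orbitRel.Quotient (Fin d → ℤ) 𝒱)]
    [DecidableEq (AddAction.orbitRel.Quotient (Fin d → ℤ) 𝒱)]
    {χ : Multiplicative (Fin d → ℤ) →* ℝ} (hχ : ∀ a, 0 < χ a) (k : ℕ)
    (p q : AddAction.orbitRel.Quotient (Fin d → ℤ) 𝒱) : 0 ≤ (hG.quotientAdj χ ^ k) p q := by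
  induction k generalizing p with
  | zero => rw [pow_zero, Matrix.one_apply]; split_ifs <;> simp
  | succ k ih =>
    rw [pow_succ', Matrix.mul_apply]
    exact Finset.sum_nonneg fun m _ => mul_nonneg (hG.quotientAdj_nonneg hχ _ _) (ih m)

/-- A single edge bounds below the entry of the weighted adjacency matrix to which it
contributes. -/
theorem IsPeriodicGraph.le_mul_quotientAdj (hG : IsPeriodicGraph d G)
    {χ : Multiplicative (Fin d → ℤ) →* ℝ} (hχ : ∀ a, 0 < χ a)
    {p q : AddAction.orbitRel.Quotient (Fin d → ℤ) 𝒱} {b c : Fin d → ℤ}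
    (h : G.Adj (b +ᵥ p.out) (c +ᵥ q.out)) :
    χ (.ofAdd c) ≤ χ (.ofAdd b) * hG.quotientAdj χ p q := by
  have hmem : c - b ∈ (hG.finite_shifts p.out q.out).toFinset := by
    rw [Set.Finite.mem_toFinset]
    change G.Adj _ _
    rwa [← hG.adj_vadd_iff b, vadd_vadd, add_sub_cancel]
  calc χ (.ofAdd c) = χ (.ofAdd b) * χ (.ofAdd (c - b)) := by
        rw [← map_mul, ← ofAdd_add, add_sub_cancel]
    _ ≤ _ := mul_le_mul_of_nonneg_left
        (Finset.single_le_sum (f := fun a => χ (.ofAdd a)) (fun _ _ => (hχ _).le) hmem) (hχ _).le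

/-- A walk of length `k` bounds below the corresponding entry of the `k`-th power of the weighted
adjacency matrix, all of whose terms are positive. -/
theorem IsPeriodicGraph.le_mul_pow_quotientAdj (hG : IsPeriodicGraph d G)
    [Fintype (AddAction.orbitRel.Quotient (Fin d → ℤ) 𝒱)]
    [DecidableEq (AddAction.orbitRel.Quotient (Fin d → ℤ) 𝒱)]
    {χ : Multiplicative (Fin d → ℤ) →* ℝ} (hχ : ∀ a, 0 < χ a) {x y : 𝒱} (P : G.Walk x y)
    {p q : AddAction.orbitRel.Quotient (Fin d → ℤ) 𝒱} {b c : Fin d → ℤ}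
    (hx : x = b +ᵥ p.out) (hy : y = c +ᵥ q.out) :
    χ (.ofAdd c) ≤ χ (.ofAdd b) * (hG.quotientAdj χ ^ P.length) p q := by
  induction P generalizing p b with
  | nil =>
    have hmk (a : Fin d → ℤ) (m : AddAction.orbitRel.Quotient (Fin d → ℤ) 𝒱) :
        (Quotient.mk'' (a +ᵥ m.out) : AddAction.orbitRel.Quotient (Fin d → ℤ) 𝒱) = m :=
      (orbitMk_vadd a m.out).trans (Quotient.out_eq' m)
    have hpq : p = q := by rw [← hmk b p, ← hx, hy, hmk]
    subst hpq
    have hbc : c = b := by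
      refine (neg_add_eq_zero.mp (hG.free (-b + c) p.out ?_)).symm
      rw [add_vadd, ← hy, hx, neg_vadd_vadd]
    rw [hbc, SimpleGraph.Walk.length_nil, pow_zero, Matrix.one_apply_eq, mul_one]
  | @cons x x' y hadj P ih =>
    let m : AddAction.orbitRel.Quotient (Fin d → ℤ) 𝒱 := Quotient.mk'' x'
    obtain ⟨a, ha⟩ : ∃ a : Fin d → ℤ, a +ᵥ m.out = x' :=
      exists_vadd_out_eq x'
    have h1 := ih ha.symm hy
    have h2 := hG.le_mul_quotientAdj hχ (p := p) (q := m) (b := b) (c := a)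
      (by rwa [ha, ← hx])
    have h3 := hG.pow_quotientAdj_nonneg hχ P.length m q
    rw [SimpleGraph.Walk.length_cons, pow_succ', Matrix.mul_apply]
    calc χ (.ofAdd c) ≤ χ (.ofAdd a) * (hG.quotientAdj χ ^ P.length) m q := h1
      _ ≤ (χ (.ofAdd b) * hG.quotientAdj χ p m) * (hG.quotientAdj χ ^ P.length) m q :=
        mul_le_mul_of_nonneg_right h2 h3
      _ = χ (.ofAdd b) * (hG.quotientAdj χ p m * (hG.quotientAdj χ ^ P.length) m q) :=
        mul_assoc _ _ _
      _ ≤ _ := mul_le_mul_of_nonneg_left (Finset.single_le_sum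
          (f := fun m => hG.quotientAdj χ p m * (hG.quotientAdj χ ^ P.length) m q)
          (fun m _ => mul_nonneg (hG.quotientAdj_nonneg hχ _ _)
            (hG.pow_quotientAdj_nonneg hχ _ _ _)) (Finset.mem_univ m)) (hχ _).le

theorem IsPeriodicGraph.quotientAdj_pos_of_adj (hG : IsPeriodicGraph d G)
    {χ : Multiplicative (Fin d → ℤ) →* ℝ} (hχ : ∀ a, 0 < χ a) {x y : 𝒱} (h : G.Adj x y) :
    0 < hG.quotientAdj χ (Quotient.mk'' x) (Quotient.mk'' y) := by
  obtain ⟨b, hb⟩ : ∃ b : Fin d → ℤ,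
      b +ᵥ (Quotient.mk'' x : AddAction.orbitRel.Quotient (Fin d → ℤ) 𝒱).out = x :=
    exists_vadd_out_eq x
  obtain ⟨c, hc⟩ : ∃ c : Fin d → ℤ,
      c +ᵥ (Quotient.mk'' y : AddAction.orbitRel.Quotient (Fin d → ℤ) 𝒱).out = y :=
    exists_vadd_out_eq y
  have h1 := hG.le_mul_quotientAdj hχ (b := b) (c := c) (by rwa [hb, hc])
  exact pos_of_mul_pos_right ((hχ _).trans_le h1) (hχ _).le

/-- As `G` is connected, the weighted adjacency matrix of the quotient graph decouples no two
complementary sets of orbits. -/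
theorem IsPeriodicGraph.exists_quotientAdj_mul_ne_zero (hG : IsPeriodicGraph d G)
    (hconn : G.Connected) {χ : Multiplicative (Fin d → ℤ) →* ℝ} (hχ : ∀ a, 0 < χ a)
    (U : Set (AddAction.orbitRel.Quotient (Fin d → ℤ) 𝒱)) (hU : U.Nonempty) (hU' : Uᶜ.Nonempty) :
    ∃ p ∈ U, ∃ q ∉ U, hG.quotientAdj χ p q * hG.quotientAdj χ q p ≠ 0 := by
  obtain ⟨p, hp⟩ := hU
  obtain ⟨q, hq⟩ := hU'
  obtain ⟨P⟩ := hconn.preconnected p.out q.out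
  obtain ⟨e, -, h1, h2⟩ := P.exists_boundary_dart {x | Quotient.mk'' x ∈ U}
    (by change Quotient.mk'' p.out ∈ U; rwa [Quotient.out_eq'])
    (by change Quotient.mk'' q.out ∉ U; rwa [Quotient.out_eq'])
  exact ⟨_, h1, _, h2, (mul_pos (hG.quotientAdj_pos_of_adj hχ e.adj)
    (hG.quotientAdj_pos_of_adj hχ e.adj.symm)).ne'⟩

/-- The character `a ↦ t ^ (a i)` of `ℤ^d`. -/
noncomputable def coordChar {d : ℕ} (i : Fin d) (t : ℝ) (ht : t ≠ 0) :
    Multiplicative (Fin d → ℤ) →* ℝ where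
  toFun a := t ^ (a.toAdd i)
  map_one' := by simp
  map_mul' a b := by rw [toAdd_mul, Pi.add_apply, zpow_add₀ ht]

/-- With unit edge labels and zero potential the Floquet matrices have different spectra at two
points of the torus: a closed walk in the quotient graph that is not closed in `G` makes the trace
of a power of the matrix as large as desired. -/
theorem IsPeriodicGraph.exists_charpoly_quotientAdj_ne (hG : IsPeriodicGraph d G) (hd : 1 ≤ d)
    (hconn : G.Connected) [Fintype (AddAction.orbitRel.Quotient (Fin d → ℤ) 𝒱)]
    [DecidableEq (AddAction.orbitRel.Quotient (Fin d → ℤ) 𝒱)] :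
    ∃ χ₁ χ₂ : Multiplicative (Fin d → ℤ) →* ℝ, (∀ a, 0 < χ₁ a) ∧
      ((hG.quotientAdj χ₁).map Complex.ofRealHom).charpoly ≠
        ((hG.quotientAdj χ₂).map Complex.ofRealHom).charpoly := by
  obtain ⟨x⟩ := hconn.nonempty
  let p : AddAction.orbitRel.Quotient (Fin d → ℤ) 𝒱 := Quotient.mk'' x
  let i : Fin d := ⟨0, hd⟩
  let c : Fin d → ℤ := Pi.single i 1
  obtain ⟨P⟩ := hconn.preconnected p.out (c +ᵥ p.out)
  let k := P.length
  let χ₁ := coordChar i 1 one_ne_zero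
  have hχ₁ (a) : 0 < χ₁ a := zpow_pos one_pos _
  let T := (hG.quotientAdj χ₁ ^ k).trace
  have hT : 0 ≤ T := Finset.sum_nonneg fun q _ => hG.pow_quotientAdj_nonneg hχ₁ k q q
  have ht : 0 < T + 1 := by positivity
  -- the walk `P` has weight `T + 1` at `χ₂`, so the trace of the `k`-th power exceeds `T` there
  let χ₂ := coordChar i (T + 1) ht.ne'
  have hχ₂ (a) : 0 < χ₂ a := zpow_pos ht _
  refine ⟨χ₁, χ₂, hχ₁, fun heq => ?_⟩
  have h1 : T + 1 ≤ (hG.quotientAdj χ₂ ^ k) p p := by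
    have := hG.le_mul_pow_quotientAdj hχ₂ P (p := p) (q := p) (b := 0) (c := c)
      (zero_vadd _ _).symm rfl
    simpa [χ₂, coordChar, c] using this
  have h2 : (hG.quotientAdj χ₂ ^ k) p p ≤ (hG.quotientAdj χ₂ ^ k).trace :=
    Finset.single_le_sum (f := fun q => (hG.quotientAdj χ₂ ^ k) q q)
      (fun q _ => hG.pow_quotientAdj_nonneg hχ₂ k q q) (Finset.mem_univ p)
  have h3 := Matrix.trace_pow_eq_of_charpoly_eq heq k
  have h4 (χ : Multiplicative (Fin d → ℤ) →* ℝ) :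
      ((hG.quotientAdj χ).map Complex.ofRealHom ^ k).trace =
        (((hG.quotientAdj χ ^ k).trace : ℝ) : ℂ) := by
    rw [← RingHom.mapMatrix_apply, ← map_pow, RingHom.mapMatrix_apply, ← AddMonoidHom.map_trace]
    rfl
  rw [h4, h4] at h3
  have h5 : T = (hG.quotientAdj χ₂ ^ k).trace := Complex.ofReal_injective h3
  linarith

end UnitWeights

/-! ### Generic absence of flat bands -/

theorem mainTheorem2 {d : ℕ} (hd : 1 ≤ d) {𝒱 : Type*} [AddAction (Fin d → ℤ) 𝒱]
    (G : SimpleGraph 𝒱) (hG : IsPeriodicGraph d G) (hconn : G.Connected) :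
    ∃ S : Set (PeriodicLabeling d G), IsAlgebraicSubset S ∧ S ≠ Set.univ ∧
      ∀ ℓ : PeriodicLabeling d G, ℓ ∉ S →
        ∀ W : Finset 𝒱, IsVertexFundamentalDomain d W →
          ¬ HasLinearFactor (dispersionPolynomial hG ℓ W) := by
  classical
  have := hG.finite_vertexOrbits
  let := Fintype.ofFinite (AddAction.orbitRel.Quotient (Fin d → ℤ) 𝒱)
  obtain ⟨x⟩ := hconn.nonempty
  have : Nonempty (AddAction.orbitRel.Quotient (Fin d → ℤ) 𝒱) := ⟨Quotient.mk'' x⟩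
  obtain ⟨χ₁, χ₂, hχ₁, hne⟩ := hG.exists_charpoly_quotientAdj_ne hd hconn
  let ψ₁ := (Complex.ofRealHom : ℝ →* ℂ).comp χ₁
  let ψ₂ := (Complex.ofRealHom : ℝ →* ℂ).comp χ₂
  let r : AddAction.orbitRel.Quotient (Fin d → ℤ) 𝒱 → 𝒱 := Quotient.out
  -- `F` vanishes at every labeling whose Floquet matrices at `ψ₁`, `ψ₂` share an eigenvalue
  let F := (Polynomial.aeval (hG.genericFloquetAt ψ₁ r) (hG.genericFloquetAt ψ₂ r).charpoly).det
  have hF (ℓ : PeriodicLabeling d G) : MvPolynomial.eval ℓ.values F =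
      (Polynomial.aeval (ℓ.floquetAt ψ₁ r) (ℓ.floquetAt ψ₂ r).charpoly).det := by
    rw [Matrix.map_det_aeval_charpoly, hG.map_eval_genericFloquetAt,
      hG.map_eval_genericFloquetAt]
  refine ⟨{ℓ | MvPolynomial.eval ℓ.values F = 0}, ⟨{F}, by simp⟩, ?_, ?_⟩
  · obtain ⟨v, hv⟩ := Matrix.exists_det_aeval_charpoly_diagonal_add_ne_zero (fun U hU hU' => by
      obtain ⟨p, hp, q, hq, hpq⟩ := hG.exists_quotientAdj_mul_ne_zero hconn hχ₁ U hU hU'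
      refine ⟨p, hp, q, hq, ?_⟩
      rw [Matrix.map_apply, Matrix.map_apply, ← map_mul]
      exact (map_ne_zero _).mpr hpq) hne
    rw [← hG.floquetAt_unitLabeling, ← hG.floquetAt_unitLabeling, ← hF] at hv
    exact fun h => hv (h.ge (Set.mem_univ (hG.unitLabeling v)))
  · intro ℓ hℓ W hW hlin
    obtain ⟨lam, hlam⟩ := hlin.exists_isRoot
    obtain ⟨e, s, hs⟩ := hW.exists_equiv
    refine hℓ ((hF ℓ).trans (Matrix.det_aeval_charpoly_eq_zero (a := lam) ?_ ?_))
    · rw [← ℓ.charpoly_floquetAt_eq ψ₁ e _ r s hs]; exact hlam ψ₁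
    · rw [← ℓ.charpoly_floquetAt_eq ψ₂ e _ r s hs]; exact hlam ψ₂
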